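/- For a Borel probability measure $\mu$ on $\mathbb{R}^d$ and $t \ge 0$ let \[ W_t^{\mu}=\{\,x\in\mathbb{R}^d : \text{there is a closed halfspace } h \text{ with } x\in h \text{ and } \mu(h)\le t\,\},\qquad w^{\mu}(t)=\mu(W_t^{\mu}). \] Let $P_n^{\mu}$ be the convex hull of $n$ independent random points with distribution $\mu$, and let $f_0(P_n^{\mu})$ be its number of vertices. Call $\mu$ non-atomic if $\mu(\{x\})=0$ for every $x\in\mathbb{R}^d$. (i) For every $d$ there is a sequence $\varepsilon_d(n)$ of real numbers, depending only on $d$ and $n$ (not on $\mu$), with $\varepsilon_d(n)\to 0$ as $n\to\infty$, such that for every non-atomic Borel probability measure $\mu$ on $\mathbb{R}^d$ and every $n\ge 1$, \[ \frac1e\, n\, w^{\mu}\!\left(\tfrac1n\right)\ \le\ \mathbb{E}\left[f_0(P_n^{\mu})\right]\ \le\ n\, w^{\mu}\!\left((d+2)\tfrac{\ln n}{n}\right)+\varepsilon_d(n). \] (ii) There exists a non-atomic Borel probability measure $\nu$ on $\mathbb{R}^2$ such that \[ \mathbb{E}\left[f_0(P_n^{\nu})\right] > \frac12\, n\, w^{\nu}\!\left(\tfrac{\log_2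 n}{n}\right) \] for infinitely many $n$. -/

import Mathlib

open MeasureTheory Filter Topology

noncomputable section

/-- A closed halfspace of `ℝ^d`: `{y | c ≤ ⟨a, y⟩}` with `a ≠ 0`. -/
def IsClosedHalfspace {d : ℕ} (h : Set (EuclideanSpace ℝ (Fin d))) : Prop :=
  ∃ a : EuclideanSpace ℝ (Fin d), a ≠ 0 ∧ ∃ c : ℝ, h = {y | c ≤ inner ℝ a y}

/-- The wet part `W_t^μ`: the points lying in some halfspace of `μ`-measure at most `t`. -/
def wetPart {d : ℕ} (μ : Measure (EuclideanSpace ℝ (Fin d))) (t : ℝ) :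
    Set (EuclideanSpace ℝ (Fin d)) :=
  {x | ∃ h, IsClosedHalfspace h ∧ x ∈ h ∧ μ.real h ≤ t}

/-- `w^μ(t) = μ(W_t^μ)`. -/
def wetMeasure {d : ℕ} (μ : Measure (EuclideanSpace ℝ (Fin d))) (t : ℝ) : ℝ :=
  μ.real (wetPart μ t)

/-- The polytope spanned by the sample points `x 0, …, x (n-1)`. -/
def samplePolytope {d n : ℕ} (x : Fin n → EuclideanSpace ℝ (Fin d)) :
    Set (EuclideanSpace ℝ (Fin d)) :=
  convexHull ℝ (Set.range x)

/-- `f_0(P)`: the number of vertices (extreme points) of a polytope `P`. -/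
def numVertices {d : ℕ} (P : Set (EuclideanSpace ℝ (Fin d))) : ℕ :=
  (P.extremePoints ℝ).ncard

/-- The law of a sample of `n` independent points with distribution `μ`. -/
def sampleLaw {d : ℕ} (μ : Measure (EuclideanSpace ℝ (Fin d))) (n : ℕ) :
    Measure (Fin n → EuclideanSpace ℝ (Fin d)) :=
  Measure.pi fun _ => μ

/-- `E[f_0(P_n^μ)]`. -/
def expectedVertices {d : ℕ} (μ : Measure (EuclideanSpace ℝ (Fin d))) (n : ℕ) : ℝ :=
  ∫ x, (numVertices (samplePolytope x) : ℝ) ∂(sampleLaw μ n)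

end

/-! Almost surely the sample points are distinct, so by linearity the expected number of vertices is
`n` times the `μ`-average over `y` of the probability that `y` is outside the hull of `n - 1` sample
points (`outsideProb`). Lower bound: a halfspace through `y` of measure at most `1/n` is missed by
all these points with probability at least `(1 - 1/n)^(n-1) ≥ 1/e`, and then the hull misses `y`.
Upper bound: let every halfspace through `y` have measure above `t`. If the hull misses `y`, its
point nearest to `y` is spanned by a set `S` of at most `d` sample points, and the remaining points
miss the halfspace through `y` cut off orthogonally to the direction of that nearest point. Given
`S` this costs at most `exp (-t)` per remaining point. A union bound over at most `N^d` sets `S`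
gives `outsideProb_le_of_forall_halfspace`; the factor `(d + 2) log n / n` makes the total error
about `1/n`. Part (ii): take concentric circles of radii `2^i` with tail masses shrinking so fast
that at scale `n` about `1/(4 * tailMass (i+1))` the sample probably has no point beyond circle `i`,
while `log n / n` is still below a sixth of the mass of circle `i`. Each point on or beyond circle
`i` is then a vertex with probability at least `3/4` when sampled, and up to a null set the wet part
lies in that region. -/

/-! ### Convex hulls of finitely many points: measurability and vertices -/

section ConvexHull

variable {E ι : Type*} [NormedAddCommGroup E] [NormedSpace ℝ E] [Fintype ι]

theorem mem_convexHull_range_iff_exists_stdSimplex (X : ι → E) (y : E) :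
    y ∈ convexHull ℝ (Set.range X) ↔ ∃ w : stdSimplex ℝ ι, ∑ i, w.1 i • X i = y := by
  classical
  constructor
  · intro hy
    have hsub : Set.range X ⊆
        Set.range (fun w : stdSimplex ℝ ι => ∑ i, w.1 i • X i) := by
      rintro _ ⟨i, rfl⟩
      exact ⟨⟨Pi.single i 1, single_mem_stdSimplex ℝ i⟩, by simp [Pi.single_apply]⟩
    have hconv : Convex ℝ (Set.range (fun w : stdSimplex ℝ ι => ∑ i, w.1 i • X i)) := by
      rintro _ ⟨v, rfl⟩ _ ⟨w, rfl⟩ a b ha hb hab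
      refine ⟨⟨a • v.1 + b • w.1, convex_stdSimplex ℝ ι v.2 w.2 ha hb hab⟩, ?_⟩
      simp [add_smul, Finset.sum_add_distrib, Finset.smul_sum, mul_smul]
    exact convexHull_min hsub hconv hy
  · rintro ⟨w, rfl⟩
    exact (convex_convexHull ℝ _).sum_mem (fun i _ => w.2.1 i) w.2.2
      fun i _ => subset_convexHull ℝ _ ⟨i, rfl⟩

/-- The set is the projection of a closed condition along the compact simplex of weights, and such
projections are closed maps. -/
theorem isClosed_setOf_exists_convexHull_range_dist_le (r : ℝ) :
    IsClosed {p : E × (ι → E) | ∃ z ∈ convexHull ℝ (Set.range p.2), dist p.1 z ≤ r} := by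
  have hc : IsClosed {q : stdSimplex ℝ ι × (E × (ι → E)) |
      dist q.2.1 (∑ i, q.1.1 i • q.2.2 i) ≤ r} := by
    refine isClosed_le ?_ continuous_const
    refine continuous_snd.fst.dist (continuous_finsetSum _ fun i _ => ?_)
    exact ((continuous_apply i).comp (continuous_subtype_val.comp continuous_fst)).smul
      ((continuous_apply i).comp continuous_snd.snd)
  convert! isClosedMap_snd_of_compactSpace _ hc using 1
  ext ⟨y, X⟩
  simp [mem_convexHull_range_iff_exists_stdSimplex]

theorem isClosed_setOf_mem_convexHull_range :
    IsClosed {p : E × (ι → E) | p.1 ∈ convexHull ℝ (Set.range p.2)} := by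
  convert! isClosed_setOf_exists_convexHull_range_dist_le (E := E) (ι := ι) 0 using 1
  ext ⟨y, X⟩
  simp

theorem measurable_infDist_convexHull_range [Nonempty ι] [MeasurableSpace E] [BorelSpace E]
    [SecondCountableTopology E] (y : E) :
    Measurable fun X : ι → E => Metric.infDist y (convexHull ℝ (Set.range X)) := by
  refine measurable_of_Iic fun r => IsClosed.measurableSet ?_
  have hcomp : ∀ X : ι → E, IsCompact (convexHull ℝ (Set.range X)) := fun X =>
    (Set.finite_range X).isCompact_convexHull ℝ
  convert! (isClosed_setOf_exists_convexHull_range_dist_le (E := E) (ι := ι) r).preimage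
    (show Continuous fun X : ι → E => (y, X) by fun_prop) using 1
  ext X
  have hne : (convexHull ℝ (Set.range X)).Nonempty := (Set.range_nonempty X).convexHull
  simp only [Set.mem_preimage, Set.mem_Iic, Set.mem_ofPred_eq]
  constructor
  · intro h
    obtain ⟨z, hz, hd⟩ := (hcomp X).exists_infDist_eq_dist hne y
    exact ⟨z, hz, hd ▸ h⟩
  · rintro ⟨z, hz, hd⟩
    exact (Metric.infDist_le_dist_of_mem hz).trans hd

/-- A point of `s` is a vertex of `convexHull s` iff it is not spanned by the others. -/
theorem mem_extremePoints_convexHull_iff {s : Set E} {x : E} (hx : x ∈ s) :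
    x ∈ (convexHull ℝ s).extremePoints ℝ ↔ x ∉ convexHull ℝ (s \ {x}) := by
  constructor
  · intro h hmem
    rw [(convex_convexHull ℝ s).mem_extremePoints_iff_mem_sdiff_convexHull_sdiff] at h
    exact h.2 (convexHull_mono (Set.sdiff_subset_sdiff_left (subset_convexHull ℝ s)) hmem)
  · intro h
    rcases (s \ {x}).eq_empty_or_nonempty with he | hne
    · have : s = {x} := by
        refine Set.Subset.antisymm (Set.sdiff_eq_empty.1 he) (by simpa using hx)
      simp [this]
    have hs : s = insert x (s \ {x}) := by
      ext z; by_cases hz : z = x <;> simp [hz, hx]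
    set T := s \ {x} with hT
    -- Every point of the hull is a combination of `x` and a point of `convexHull T`. If a segment
    -- between two such points, both different from `x`, passed through `x`, cancelling the
    -- `x`-parts would put `x` in `convexHull T`.
    have hconv : Convex ℝ (convexHull ℝ s \ {x}) := by
      rw [hs, convexHull_insert hne]
      rintro u ⟨hu, hux⟩ v ⟨hv, hvx⟩ a b ha hb hab
      refine ⟨?_, ?_⟩
      · rw [← convexHull_insert hne] at *
        exact convex_convexHull ℝ _ hu hv ha hb hab
      · simp only [mem_convexJoin, Set.mem_singleton_iff, exists_eq_left] at hu hv
        obtain ⟨p, hp, c, c', hc, hc', hcc, rfl⟩ := hu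
        obtain ⟨q, hq, e, e', he, he', hee, rfl⟩ := hv
        have hcpos : 0 < c' := by
          refine lt_of_le_of_ne hc' fun h0 => hux ?_
          have : c = 1 := by linarith
          simp [← h0, this]
        have hepos : 0 < e' := by
          refine lt_of_le_of_ne he' fun h0 => hvx ?_
          have : e = 1 := by linarith
          simp [← h0, this]
        intro heq
        apply h
        have hpos : 0 < a * c' + b * e' := by
          rcases ha.eq_or_lt with h0 | h0
          · have : b = 1 := by linarith
            simp [← h0, this, hepos]
          · have := mul_pos h0 hcpos
            have := mul_nonneg hb he'
            linarith
        have hx' : x = (a * c' / (a * c' + b * e')) • p + (b * e' / (a * c' + b * e')) • q := by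
          have h1 : (a * c' + b * e') • x = (a * c') • p + (b * e') • q := by
            have h2 : a • (c • x + c' • p) + b • (e • x + e' • q) = x := heq
            have h3 : c = 1 - c' := by linarith
            have h4 : e = 1 - e' := by linarith
            rw [h3, h4] at h2
            have h6 : (a * c' + b * e') • x = (a + b) • x - (a • ((1 - c') • x + c' • p)
                + b • ((1 - e') • x + e' • q)) + (a * c') • p + (b * e') • q := by module
            rw [h6, h2, hab]; module
          rw [div_eq_inv_mul, div_eq_inv_mul, mul_smul _ (a * c'), mul_smul _ (b * e'), ← smul_add,
            ← h1, smul_smul, inv_mul_cancel₀ hpos.ne', one_smul]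
        rw [hx']
        refine convex_convexHull ℝ T hp hq (by positivity) (by positivity) ?_
        rw [← add_div, div_self hpos.ne']
    exact ((convex_convexHull ℝ s).mem_extremePoints_iff_convex_sdiff).2
      ⟨subset_convexHull ℝ s hx, hconv⟩

/-- Injectivity makes deleting the point `x i` the same as deleting the index `i`, so vertices can
be counted by index. -/
theorem extremePoints_convexHull_range_eq_image {n : ℕ} (x : Fin (n + 1) → E)
    (hx : Function.Injective x) :
    (convexHull ℝ (Set.range x)).extremePoints ℝ =
      x '' {i | x i ∉ convexHull ℝ (Set.range fun j => x (i.succAbove j))} := by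
  have key : ∀ i, Set.range x \ {x i} = Set.range fun j => x (i.succAbove j) := by
    intro i
    have : (fun j => x (i.succAbove j)) = x ∘ i.succAbove := rfl
    rw [this, Set.range_comp, Fin.range_succAbove, Set.image_compl_eq_range_sdiff_image hx,
      Set.image_singleton]
  ext z
  constructor
  · intro hz
    obtain ⟨i, rfl⟩ := extremePoints_convexHull_subset hz
    refine ⟨i, ?_, rfl⟩
    rw [mem_extremePoints_convexHull_iff (Set.mem_range_self i), key] at hz
    exact hz
  · rintro ⟨i, hi, rfl⟩
    rw [mem_extremePoints_convexHull_iff (Set.mem_range_self i), key]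
    exact hi

end ConvexHull

/-! ### Nearest points and their supporting hyperplanes -/

section NearestPoint

variable {E : Type*} [NormedAddCommGroup E] [InnerProductSpace ℝ E]

theorem inner_le_zero_of_dist_eq_infDist {K : Set E} (hK : Convex ℝ K) {y p : E} (hp : p ∈ K)
    (hd : Metric.infDist y K = dist y p) : ∀ v ∈ K, inner ℝ (y - p) (v - p) ≤ 0 := by
  rw [← norm_eq_iInf_iff_real_inner_le_zero hK hp, ← dist_eq_norm, ← hd, Metric.infDist_eq_iInf]
  simp [dist_eq_norm]

theorem inner_sub_neg_of_dist_eq_infDist {K : Set E} (hK : Convex ℝ K) {y p : E} (hp : p ∈ K)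
    (hd : Metric.infDist y K = dist y p) (hy : y ∉ K) : ∀ v ∈ K, inner ℝ (y - p) v <
      inner ℝ (y - p) y := by
  intro v hv
  have h1 := inner_le_zero_of_dist_eq_infDist hK hp hd v hv
  have h2 : 0 < inner ℝ (y - p) (y - p) := by
    rw [real_inner_self_pos, sub_ne_zero]
    rintro rfl; exact hy hp
  simp only [inner_sub_right] at h1 h2 ⊢
  linarith

/-- The point of a polytope nearest to an outside point is spanned by at most `dim E` of the
generators. -/
theorem exists_finset_card_le_finrank_infDist_le [FiniteDimensional ℝ E] {ι : Type*} [Fintype ι]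
    [Nonempty ι] (X : ι → E) (y : E) (hy : y ∉ convexHull ℝ (Set.range X)) :
    ∃ S : Finset ι, S.Nonempty ∧ S.card ≤ Module.finrank ℝ E ∧
      Metric.infDist y (convexHull ℝ (X '' S)) ≤
        Metric.infDist y (convexHull ℝ (Set.range X)) := by
  classical
  have hcomp : IsCompact (convexHull ℝ (Set.range X)) := (Set.finite_range X).isCompact_convexHull ℝ
  obtain ⟨p, hp, hd⟩ := hcomp.exists_infDist_eq_dist (Set.range_nonempty X).convexHull y
  obtain ⟨κ, _, z, w, hz, hai, hw, hw1, hsum⟩ := eq_pos_convex_span_of_mem_convexHull hp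
  have hle := inner_le_zero_of_dist_eq_infDist (convex_convexHull ℝ _) hp hd
  have hle' : ∀ k, inner ℝ (y - p) (z k - p) ≤ 0 := fun k =>
    hle _ (subset_convexHull ℝ _ (hz ⟨k, rfl⟩))
  have hzero : ∑ k, w k * inner ℝ (y - p) (z k - p) = 0 := by
    have : ∑ k, w k • (z k - p) = 0 := by
      simp [smul_sub, Finset.sum_sub_distrib, hsum, ← Finset.sum_smul, hw1]
    rw [← inner_zero_right (𝕜 := ℝ) (y - p), ← this, inner_sum]
    simp [inner_smul_right]
  -- Nonpositive terms with positive weights sum to zero, so every generator used by `p` lies on the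
  -- hyperplane through `p` orthogonal to `y - p`.
  have hz0 : ∀ k, inner ℝ (y - p) (z k - p) = 0 := by
    intro k
    have := (Finset.sum_eq_zero_iff_of_nonpos (fun k _ =>
      mul_nonpos_of_nonneg_of_nonpos (hw k).le (hle' k))).1 hzero k (Finset.mem_univ _)
    exact (mul_eq_zero.1 this).resolve_left (hw k).ne'
  have hne : y - p ≠ 0 := by
    rw [sub_ne_zero]; rintro rfl; exact hy hp
  have hspan : vectorSpan ℝ (Set.range z) ≤ (Submodule.span ℝ {y - p})ᗮ := by
    rw [vectorSpan_def, Submodule.span_le]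
    rintro _ ⟨_, ⟨k, rfl⟩, _, ⟨l, rfl⟩, rfl⟩
    rw [SetLike.mem_coe, Submodule.mem_orthogonal_singleton_iff_inner_right]
    have := hz0 k
    have := hz0 l
    simp only [vsub_eq_sub, inner_sub_right] at *
    linarith
  -- Affinely independent points in a hyperplane: one fewer than Carathéodory's bound.
  have hcard : Fintype.card κ ≤ Module.finrank ℝ E := by
    have h1 := hai.card_le_finrank_succ
    have h2 := Submodule.finrank_mono hspan
    have h3 := Submodule.finrank_add_finrank_orthogonal (Submodule.span ℝ {y - p})
    rw [finrank_span_singleton hne] at h3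
    omega
  have hκ : Nonempty κ := by
    by_contra hemp
    rw [not_nonempty_iff] at hemp
    simp at hw1
  choose g hg using fun k => hz (Set.mem_range_self k)
  refine ⟨Finset.univ.image g, by simp, Finset.card_image_le.trans (by simpa using hcard), ?_⟩
  rw [hd]
  refine Metric.infDist_le_dist_of_mem ?_
  rw [← hsum]
  refine (convex_convexHull ℝ _).sum_mem (fun k _ => (hw k).le) hw1 fun k _ =>
    subset_convexHull ℝ _ ⟨g k, by simp, hg k⟩

end NearestPoint

/-! ### Conditioning on a few coordinates of a product measure -/

section PiMeasure

variable {E ι : Type*} [MeasurableSpace E] [Fintype ι]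

/-- By Fubini: once the coordinates in `S` are fixed, the others are independent and each lies in a
slice of measure at most `q`. -/
theorem pi_setOf_forall_notMem_le (μ : Measure E) [IsProbabilityMeasure μ] (S : Finset ι)
    {M : Set (({i // i ∈ S} → E) × E)} (hM : MeasurableSet M) (q : ENNReal)
    (hq : ∀ Z, μ {v | (Z, v) ∈ M} ≤ q) :
    (Measure.pi fun _ : ι => μ) {X | ∀ j, j ∉ S → (fun i : {i // i ∈ S} => X i, X j) ∈ M} ≤
      q ^ (Fintype.card ι - S.card) := by
  classical
  have hmp := measurePreserving_piEquivPiSubtypeProd (fun _ : ι => μ) (fun i => i ∈ S)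
  set B : Set (({i // i ∈ S} → E) × ({i // i ∉ S} → E)) := {p | ∀ j, (p.1, p.2 j) ∈ M}
  have hB : MeasurableSet B := by
    have : B = ⋂ j, (fun p : ({i // i ∈ S} → E) × ({i // i ∉ S} → E) => (p.1, p.2 j)) ⁻¹' M := by
      ext; simp [B]
    rw [this]
    exact MeasurableSet.iInter fun j => hM.preimage (by fun_prop)
  have hset : {X : ι → E | ∀ j, j ∉ S → (fun i : {i // i ∈ S} => X i, X j) ∈ M} =
      MeasurableEquiv.piEquivPiSubtypeProd (fun _ => E) (fun i => i ∈ S) ⁻¹' B := by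
    ext X
    simp only [B, Set.mem_preimage, Set.mem_ofPred_eq, Subtype.forall]
    rfl
  rw [hset, hmp.measure_preimage hB.nullMeasurableSet, Measure.prod_apply hB]
  have hcard : Fintype.card {i // i ∉ S} = Fintype.card ι - S.card := by
    rw [Fintype.card_subtype_compl, Fintype.card_coe]
  refine (lintegral_mono (g := fun _ => q ^ (Fintype.card ι - S.card)) fun Z => ?_).trans (by simp)
  have : Prod.mk Z ⁻¹' B = Set.pi Set.univ fun _ => {v | (Z, v) ∈ M} := by
    ext V; simp [B]
  rw [this, Measure.pi_pi, Finset.prod_const, Finset.card_univ, ← hcard]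
  refine (pow_le_pow_left' (hq Z) _).trans_eq ?_
  congr 1

end PiMeasure

/-! ### Random samples: vertex counts and the probability of missing a point -/

section Sample

variable {d : ℕ}

/-- The probability that `y` is not in the convex hull of `N` random points. -/
noncomputable def outsideProb (μ : Measure (EuclideanSpace ℝ (Fin d))) (N : ℕ)
    (y : EuclideanSpace ℝ (Fin d)) : ℝ :=
  (Measure.pi fun _ : Fin N => μ).real {X | y ∉ convexHull ℝ (Set.range X)}

theorem measurableSet_setOf_notMem_convexHull (N : ℕ) :
    MeasurableSet {p : EuclideanSpace ℝ (Fin d) × (Fin N → EuclideanSpace ℝ (Fin d)) |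
      p.1 ∉ convexHull ℝ (Set.range p.2)} :=
  (isClosed_setOf_mem_convexHull_range
    (E := EuclideanSpace ℝ (Fin d)) (ι := Fin N)).measurableSet.compl

theorem outsideProb_nonneg (μ : Measure (EuclideanSpace ℝ (Fin d))) (N : ℕ)
    (y : EuclideanSpace ℝ (Fin d)) : 0 ≤ outsideProb μ N y :=
  measureReal_nonneg

variable (μ : Measure (EuclideanSpace ℝ (Fin d))) [IsProbabilityMeasure μ]

theorem measurable_outsideProb (N : ℕ) : Measurable (outsideProb μ N) :=
  (measurable_measure_prodMk_left (measurableSet_setOf_notMem_convexHull N)).ennreal_toReal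

theorem outsideProb_le_one (N : ℕ) (y : EuclideanSpace ℝ (Fin d)) : outsideProb μ N y ≤ 1 :=
  measureReal_le_one

theorem integrable_outsideProb (N : ℕ) : Integrable (outsideProb μ N) μ :=
  Integrable.of_bound (measurable_outsideProb μ N).aestronglyMeasurable 1
    (ae_of_all _ fun y => by
      rw [Real.norm_of_nonneg (outsideProb_nonneg μ N y)]; exact outsideProb_le_one μ N y)

theorem ae_injective_sample (hμ : ∀ x, μ {x} = 0) (N : ℕ) :
    ∀ᵐ x ∂(sampleLaw μ N), Function.Injective x := by
  have key : ∀ i j : Fin N, i ≠ j → ∀ᵐ x ∂(sampleLaw μ N), x i ≠ x j := by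
    intro i j hij
    obtain _ | N := N
    · exact i.elim0
    obtain ⟨k, rfl⟩ := Fin.exists_succAbove_eq hij.symm
    have hmp := measurePreserving_piFinSuccAbove (fun _ : Fin (N + 1) => μ) i
    have hmeas : MeasurableSet {p : EuclideanSpace ℝ (Fin d) × (Fin N → EuclideanSpace ℝ (Fin d)) |
        p.1 = p.2 k} := measurableSet_eq_fun measurable_fst (by fun_prop)
    have h0 : (μ.prod (Measure.pi fun _ : Fin N => μ))
        {p : EuclideanSpace ℝ (Fin d) × (Fin N → EuclideanSpace ℝ (Fin d)) | p.1 = p.2 k} = 0 := by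
      rw [Measure.prod_apply_symm hmeas]
      simp [Set.preimage, hμ]
    rw [← hmp.measure_preimage hmeas.nullMeasurableSet] at h0
    rw [ae_iff]
    have hset : {x : Fin (N + 1) → EuclideanSpace ℝ (Fin d) | ¬ x i ≠ x (i.succAbove k)} =
        MeasurableEquiv.piFinSuccAbove (fun _ => EuclideanSpace ℝ (Fin d)) i ⁻¹'
          {p | p.1 = p.2 k} := by
      simp only [ne_eq, not_not]; rfl
    rw [hset]
    exact h0
  have : ∀ᵐ x ∂(sampleLaw μ N), ∀ i j : Fin N, i ≠ j → x i ≠ x j := by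
    simp_rw [ae_all_iff]
    exact key
  filter_upwards [this] with x hx i j hij
  by_contra hne
  exact hx i j hne hij

theorem numVertices_samplePolytope_of_injective {N : ℕ}
    (x : Fin (N + 1) → EuclideanSpace ℝ (Fin d)) (hx : Function.Injective x) :
    (numVertices (samplePolytope x) : ℝ) = ∑ i, Set.indicator
      {x : Fin (N + 1) → EuclideanSpace ℝ (Fin d) |
        x i ∉ convexHull ℝ (Set.range fun j => x (i.succAbove j))} (fun _ => (1 : ℝ)) x := by
  classical
  rw [numVertices, samplePolytope, extremePoints_convexHull_range_eq_image x hx,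
    Set.ncard_image_of_injective _ hx]
  simp only [Set.indicator_apply, Set.mem_ofPred_eq, Finset.sum_boole]
  rw [← Set.ncard_coe_finset]
  simp

/-- Splitting coordinate `i` off the product leaves `N` independent points against which `x i` is
tested. -/
theorem sampleLaw_vertex_event {N : ℕ} (i : Fin (N + 1)) :
    MeasurableSet {x : Fin (N + 1) → EuclideanSpace ℝ (Fin d) |
        x i ∉ convexHull ℝ (Set.range fun j => x (i.succAbove j))} ∧
    (sampleLaw μ (N + 1)).real {x : Fin (N + 1) → EuclideanSpace ℝ (Fin d) |
        x i ∉ convexHull ℝ (Set.range fun j => x (i.succAbove j))} =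
      ∫ y, outsideProb μ N y ∂μ := by
  have hmp := measurePreserving_piFinSuccAbove (fun _ : Fin (N + 1) => μ) i
  have hM := measurableSet_setOf_notMem_convexHull (d := d) N
  have hset : {x : Fin (N + 1) → EuclideanSpace ℝ (Fin d) |
      x i ∉ convexHull ℝ (Set.range fun j => x (i.succAbove j))} =
      MeasurableEquiv.piFinSuccAbove (fun _ => EuclideanSpace ℝ (Fin d)) i ⁻¹'
        {p | p.1 ∉ convexHull ℝ (Set.range p.2)} := rfl
  refine ⟨hset ▸ hM.preimage (MeasurableEquiv.measurable _), ?_⟩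
  rw [hset, sampleLaw, measureReal_def, hmp.measure_preimage hM.nullMeasurableSet,
    Measure.prod_apply hM]
  exact (integral_toReal (measurable_measure_prodMk_left hM).aemeasurable
    (ae_of_all _ fun y => measure_lt_top _ _)).symm

theorem integrable_numVertices_and_expectedVertices_eq (hμ : ∀ x, μ {x} = 0) (N : ℕ) :
    Integrable (fun x : Fin (N + 1) → EuclideanSpace ℝ (Fin d) =>
      (numVertices (samplePolytope x) : ℝ)) (sampleLaw μ (N + 1)) ∧
    expectedVertices μ (N + 1) = (N + 1) * ∫ y, outsideProb μ N y ∂μ := by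
  have : IsProbabilityMeasure (sampleLaw μ (N + 1)) := by
    unfold sampleLaw; infer_instance
  have hae : (fun x : Fin (N + 1) → EuclideanSpace ℝ (Fin d) =>
      (numVertices (samplePolytope x) : ℝ)) =ᵐ[sampleLaw μ (N + 1)] fun x => ∑ i, Set.indicator
      {x : Fin (N + 1) → EuclideanSpace ℝ (Fin d) |
        x i ∉ convexHull ℝ (Set.range fun j => x (i.succAbove j))} (fun _ => (1 : ℝ)) x := by
    filter_upwards [ae_injective_sample μ hμ (N + 1)] with x hx
    exact numVertices_samplePolytope_of_injective x hx
  have hint : ∀ i : Fin (N + 1), Integrable (Set.indicator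
      {x : Fin (N + 1) → EuclideanSpace ℝ (Fin d) |
        x i ∉ convexHull ℝ (Set.range fun j => x (i.succAbove j))} (fun _ => (1 : ℝ)))
      (sampleLaw μ (N + 1)) := fun i =>
    (integrable_const _).indicator (sampleLaw_vertex_event μ i).1
  constructor
  · rw [integrable_congr hae]
    exact integrable_finsetSum _ fun i _ => hint i
  · rw [expectedVertices, integral_congr_ae hae, integral_finsetSum _ fun i _ => hint i]
    rw [Finset.sum_congr rfl fun i _ => (integral_indicator_const (1 : ℝ)
      (sampleLaw_vertex_event μ i).1).trans
        (congrArg (· • (1 : ℝ)) (sampleLaw_vertex_event μ i).2)]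
    simp

theorem expectedVertices_le (hμ : ∀ x, μ {x} = 0) {N : ℕ} {A : Set (EuclideanSpace ℝ (Fin d))}
    {δ : ℝ} (hδ : 0 ≤ δ) (hA : ∀ y, y ∉ A → outsideProb μ N y ≤ δ) :
    expectedVertices μ (N + 1) ≤ (N + 1) * (μ.real A + δ) := by
  rw [(integrable_numVertices_and_expectedVertices_eq μ hμ N).2]
  gcongr
  -- The set `A` need not be measurable, so the integral is split along this superlevel set, which
  -- is contained in `A`.
  have hB : MeasurableSet {y | δ < outsideProb μ N y} :=
    measurableSet_lt measurable_const (measurable_outsideProb μ N)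
  calc ∫ y, outsideProb μ N y ∂μ
      ≤ ∫ y, ({y | δ < outsideProb μ N y}.indicator (fun _ => (1 : ℝ)) y + δ) ∂μ := by
        refine integral_mono (integrable_outsideProb μ N)
          (((integrable_const _).indicator hB).add (integrable_const _)) fun y => ?_
        by_cases hy : δ < outsideProb μ N y
        · simp only [Set.indicator_apply, Set.mem_ofPred_eq, hy, if_true]
          linarith [outsideProb_le_one μ N y]
        · simp only [Set.indicator_apply, Set.mem_ofPred_eq, hy, if_false]
          linarith
    _ = μ.real {y | δ < outsideProb μ N y} + δ := by
        rw [integral_add ((integrable_const _).indicator hB) (integrable_const _),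
          integral_indicator_const _ hB]
        simp
    _ ≤ μ.real A + δ := by
        gcongr
        · exact measure_ne_top _ _
        · intro y hy
          by_contra hyA
          exact absurd (hA y hyA) (not_le.2 hy)

theorem le_expectedVertices (hμ : ∀ x, μ {x} = 0) {N : ℕ} {A : Set (EuclideanSpace ℝ (Fin d))}
    {δ : ℝ} (hδ : 0 ≤ δ) (hA : ∀ y ∈ A, δ ≤ outsideProb μ N y) :
    (N + 1) * (δ * μ.real A) ≤ expectedVertices μ (N + 1) := by
  rw [(integrable_numVertices_and_expectedVertices_eq μ hμ N).2]
  gcongr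
  calc δ * μ.real A ≤ δ * μ.real {y | δ ≤ outsideProb μ N y} := by
        gcongr
        · exact measure_ne_top _ _
        · exact hA
    _ ≤ _ := mul_meas_ge_le_integral_of_nonneg (ae_of_all _ (outsideProb_nonneg μ N))
        (integrable_outsideProb μ N) δ

theorem IsClosedHalfspace.measurableSet {h : Set (EuclideanSpace ℝ (Fin d))}
    (hh : IsClosedHalfspace h) : MeasurableSet h := by
  obtain ⟨a, -, c, rfl⟩ := hh
  exact (isClosed_le continuous_const (by fun_prop)).measurableSet

theorem IsClosedHalfspace.convex_compl {h : Set (EuclideanSpace ℝ (Fin d))}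
    (hh : IsClosedHalfspace h) : Convex ℝ hᶜ := by
  obtain ⟨a, -, c, rfl⟩ := hh
  have : {y | c ≤ inner ℝ a y}ᶜ = {y | innerSL ℝ a y < c} := by
    ext; simp
  rw [this]
  exact convex_halfSpace_lt (innerSL ℝ a).toLinearMap.isLinear c

/-- If all points miss `h`, so does their hull, since the complement of `h` is convex. -/
theorem pow_le_outsideProb {N : ℕ} {h : Set (EuclideanSpace ℝ (Fin d))}
    (hh : IsClosedHalfspace h) {y : EuclideanSpace ℝ (Fin d)} (hy : y ∈ h) {t : ℝ} (ht1 : t ≤ 1)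
    (ht : μ.real h ≤ t) : (1 - t) ^ N ≤ outsideProb μ N y := by
  have hpi : (Measure.pi fun _ : Fin N => μ).real (Set.pi Set.univ fun _ => hᶜ) =
      (μ.real hᶜ) ^ N := by
    simp [measureReal_def, Measure.pi_pi]
  calc (1 - t) ^ N ≤ (μ.real hᶜ) ^ N := by
        rw [probReal_compl_eq_one_sub hh.measurableSet]
        gcongr
    _ = _ := hpi.symm
    _ ≤ _ := by
        refine measureReal_mono ?_ (measure_ne_top _ _)
        intro X hX hmem
        refine convexHull_min ?_ hh.convex_compl hmem hy
        rintro _ ⟨i, rfl⟩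
        exact hX i trivial

/-- The pairs `(Z, v)` such that adding `v` to the points `Z` does not bring their convex hull,
which avoids `y`, nearer to `y`. -/
def notNearer {ι : Type*} (y : EuclideanSpace ℝ (Fin d)) :
    Set ((ι → EuclideanSpace ℝ (Fin d)) × EuclideanSpace ℝ (Fin d)) :=
  {p | 0 < Metric.infDist y (convexHull ℝ (Set.range p.1)) ∧
    Metric.infDist y (convexHull ℝ (Set.range p.1)) ≤
      Metric.infDist y (convexHull ℝ (Set.range fun o : Option ι => o.elim p.2 p.1))}

/-- Comparing distances, instead of naming the nearest point and its halfspace, makes joint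
measurability in `(Z, v)` immediate. -/
theorem measurableSet_notNearer {ι : Type*} [Fintype ι] [Nonempty ι]
    (y : EuclideanSpace ℝ (Fin d)) : MeasurableSet (notNearer (ι := ι) y) := by
  have h1 : Measurable fun p : (ι → EuclideanSpace ℝ (Fin d)) × EuclideanSpace ℝ (Fin d) =>
      Metric.infDist y (convexHull ℝ (Set.range p.1)) :=
    (measurable_infDist_convexHull_range y).comp measurable_fst
  have h2 : Measurable fun p : (ι → EuclideanSpace ℝ (Fin d)) × EuclideanSpace ℝ (Fin d) =>
      Metric.infDist y (convexHull ℝ (Set.range fun o : Option ι => o.elim p.2 p.1)) := by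
    refine (measurable_infDist_convexHull_range y).comp (measurable_pi_iff.2 fun o => ?_)
    cases o <;> simp only [Option.elim] <;> fun_prop
  exact (measurableSet_lt measurable_const h1).inter (measurableSet_le h1 h2)

/-- For fixed `Z`, the slice of `notNearer y` misses a closed halfspace through `y`. -/
theorem measure_slice_notNearer_le {ι : Type*} [Fintype ι] [Nonempty ι]
    {y : EuclideanSpace ℝ (Fin d)} {t : ℝ}
    (ht : ∀ h, IsClosedHalfspace h → y ∈ h → t < μ.real h)
    (Z : ι → EuclideanSpace ℝ (Fin d)) :
    μ {v | (Z, v) ∈ notNearer y} ≤ ENNReal.ofReal (Real.exp (-t)) := by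
  by_cases hpos : 0 < Metric.infDist y (convexHull ℝ (Set.range Z))
  swap
  · simp [notNearer, hpos]
  obtain ⟨p, hp, hd⟩ := ((Set.finite_range Z).isCompact_convexHull ℝ).exists_infDist_eq_dist
    (Set.range_nonempty Z).convexHull y
  have hne : y - p ≠ 0 := by
    rw [sub_ne_zero]; rintro rfl; simp [hd] at hpos
  set h : Set (EuclideanSpace ℝ (Fin d)) := {v | inner ℝ (y - p) y ≤ inner ℝ (y - p) v}
  have hh : IsClosedHalfspace h := ⟨y - p, hne, _, rfl⟩
  -- If `v` brings the hull no nearer, `p` is still nearest to `y` in the enlarged hull, which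
  -- therefore lies strictly on the far side of the hyperplane through `y`.
  have hsub : {v | (Z, v) ∈ notNearer y} ⊆ hᶜ := by
    rintro v ⟨-, hv⟩ hvh
    set K := convexHull ℝ (Set.range fun o : Option ι => o.elim v Z)
    have hZK : convexHull ℝ (Set.range Z) ⊆ K := by
      refine convexHull_mono ?_
      rintro _ ⟨i, rfl⟩
      exact ⟨some i, rfl⟩
    have hvK : v ∈ K := subset_convexHull ℝ _ ⟨none, rfl⟩
    have hdK : Metric.infDist y K = dist y p :=
      le_antisymm (Metric.infDist_le_dist_of_mem (hZK hp)) (hd ▸ hv)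
    have hyK : y ∉ K := by
      intro hy
      have := Metric.infDist_zero_of_mem hy
      exact absurd (this ▸ hv) (not_le.2 hpos)
    exact absurd (inner_sub_neg_of_dist_eq_infDist (convex_convexHull ℝ _) (hZK hp) hdK hyK v hvK)
      (not_lt.2 hvh)
  refine (measure_mono hsub).trans ?_
  rw [← ENNReal.ofReal_toReal (measure_ne_top μ hᶜ), ← measureReal_def,
    probReal_compl_eq_one_sub hh.measurableSet]
  refine ENNReal.ofReal_le_ofReal ?_
  linarith [ht h hh (le_refl (inner ℝ (y - p) y)), Real.add_one_le_exp (-t)]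

/-- Take `S` to be generators attaining the distance from `y` to the whole polytope: no further
sample point can then reduce it. Indexing `S` by maps `Fin d → Fin N` limits the number of
candidates to `N ^ d`. -/
theorem setOf_notMem_convexHull_subset_iUnion {N : ℕ} (hN0 : N ≠ 0)
    (y : EuclideanSpace ℝ (Fin d)) :
    {X : Fin N → EuclideanSpace ℝ (Fin d) | y ∉ convexHull ℝ (Set.range X)} ⊆
      ⋃ S ∈ Finset.univ.image (fun f : Fin d → Fin N => Finset.univ.image f),
        {X | S.Nonempty ∧
          ∀ j, j ∉ S → (fun i : {i // i ∈ S} => X i, X j) ∈ notNearer y} := by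
  classical
  have : Nonempty (Fin N) := ⟨⟨0, Nat.pos_of_ne_zero hN0⟩⟩
  intro X hX
  obtain ⟨S, hS, hcard, hdist⟩ := exists_finset_card_le_finrank_infDist_le X y hX
  rw [finrank_euclideanSpace_fin] at hcard
  have hSim : ∃ f : Fin d → Fin N, Finset.univ.image f = S := by
    have : Nonempty {i // i ∈ S} := hS.to_subtype
    obtain ⟨e⟩ : Nonempty ({i // i ∈ S} ↪ Fin d) :=
      Function.Embedding.nonempty_of_card_le (by simpa using hcard)
    refine ⟨fun k => (Function.invFun e k : {i // i ∈ S}), ?_⟩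
    ext i
    simp only [Finset.mem_image, Finset.mem_univ, true_and]
    constructor
    · rintro ⟨k, rfl⟩
      exact (Function.invFun e k).2
    · intro hi
      exact ⟨e ⟨i, hi⟩, by rw [Function.leftInverse_invFun e.injective]⟩
  obtain ⟨f, hf⟩ := hSim
  have hrange : Set.range (fun i : {i // i ∈ S} => X i) = X '' S := by
    ext; simp
  have hcomp : IsCompact (convexHull ℝ (X '' S)) :=
    (S.finite_toSet.image X).isCompact_convexHull ℝ
  have hne : (convexHull ℝ (X '' S)).Nonempty := (hS.to_set.image X).convexHull
  have hsub : X '' S ⊆ Set.range X := Set.image_subset_range _ _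
  refine Set.mem_biUnion (x := S) (by simp [← hf]) ⟨hS, fun j hj => ⟨?_, ?_⟩⟩
  · simp only [hrange]
    exact (hcomp.isClosed.notMem_iff_infDist_pos hne).1 fun h => hX (convexHull_mono hsub h)
  · simp only [hrange]
    refine hdist.trans (Metric.infDist_le_infDist_of_subset (convexHull_mono ?_) ?_)
    · rintro _ ⟨o, rfl⟩
      cases o <;> simp
    · exact (Set.range_nonempty _).convexHull

/-- If `y` is outside the polytope, then the other sample points avoid a halfspace through `y`
that is determined by at most `d` sample points. -/
theorem outsideProb_le_of_forall_halfspace {N : ℕ} (hN : d ≤ N) (hN0 : N ≠ 0)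
    {y : EuclideanSpace ℝ (Fin d)} {t : ℝ} (ht0 : 0 ≤ t)
    (ht : ∀ h, IsClosedHalfspace h → y ∈ h → t < μ.real h) :
    outsideProb μ N y ≤ (N : ℝ) ^ d * Real.exp (-t * (N - d)) := by
  classical
  set q : ENNReal := ENNReal.ofReal (Real.exp (-t)) with hq
  have hq1 : q ≤ 1 := by
    rw [hq, ENNReal.ofReal_le_one]
    exact Real.exp_le_one_iff.2 (by linarith)
  set I := Finset.univ.image (fun f : Fin d → Fin N => Finset.univ.image f)
  have hI : (I.card : ENNReal) ≤ (N : ENNReal) ^ d := by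
    have : I.card ≤ N ^ d := Finset.card_image_le.trans (by simp)
    exact_mod_cast this
  have hbound : ∀ S ∈ I, (Measure.pi fun _ : Fin N => μ) {X | S.Nonempty ∧
      ∀ j, j ∉ S → (fun i : {i // i ∈ S} => X i, X j) ∈ notNearer y} ≤ q ^ (N - d) := by
    intro S hS
    obtain ⟨f, -, rfl⟩ := Finset.mem_image.1 hS
    set S := Finset.univ.image f
    by_cases hne : S.Nonempty
    swap
    · simp [hne]
    have : Nonempty {i // i ∈ S} := hne.to_subtype
    have hcard : S.card ≤ d := Finset.card_image_le.trans (by simp)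
    simp only [hne, true_and]
    refine (pi_setOf_forall_notMem_le μ S (measurableSet_notNearer y) q
      (measure_slice_notNearer_le μ ht)).trans ?_
    rw [Fintype.card_fin]
    exact pow_le_pow_right_of_le_one' hq1 (by omega)
  have hmeas : (Measure.pi fun _ : Fin N => μ) {X | y ∉ convexHull ℝ (Set.range X)} ≤
      (N : ENNReal) ^ d * q ^ (N - d) := by
    calc _ ≤ _ := measure_mono (setOf_notMem_convexHull_subset_iUnion hN0 y)
      _ ≤ ∑ S ∈ I, _ := measure_biUnion_finset_le _ _
      _ ≤ ∑ S ∈ I, q ^ (N - d) := Finset.sum_le_sum hbound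
      _ = I.card * q ^ (N - d) := by simp
      _ ≤ _ := by gcongr
  have hreal : (N : ENNReal) ^ d * q ^ (N - d) =
      ENNReal.ofReal ((N : ℝ) ^ d * Real.exp (-t * (N - d))) := by
    rw [ENNReal.ofReal_mul (by positivity), ENNReal.ofReal_pow (by positivity),
      ENNReal.ofReal_natCast, hq, ← ENNReal.ofReal_pow (Real.exp_pos _).le, ← Real.exp_nat_mul,
      Nat.cast_sub hN, mul_comm (-t)]
  rw [hreal] at hmeas
  exact ENNReal.toReal_le_of_le_ofReal (by positivity) hmeas

end Sample

/-! ### Elementary estimates and the two bounds of part (i) -/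

theorem inv_exp_one_le_one_sub_inv_pow (N : ℕ) :
    1 / Real.exp 1 ≤ (1 - 1 / ((N : ℝ) + 1)) ^ N := by
  rcases Nat.eq_zero_or_pos N with rfl | hN
  · simpa using inv_le_one_of_one_le₀ (Real.one_le_exp zero_le_one)
  have hN' : (0 : ℝ) < N := by exact_mod_cast hN
  have h1 : 1 - 1 / ((N : ℝ) + 1) = (1 + 1 / (N : ℝ))⁻¹ := by field_simp; ring
  have h2 : (1 + 1 / (N : ℝ)) ^ N ≤ Real.exp 1 := by
    calc (1 + 1 / (N : ℝ)) ^ N ≤ Real.exp (1 / N) ^ N := by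
          gcongr
          linarith [Real.add_one_le_exp (1 / (N : ℝ))]
      _ = Real.exp 1 := by
          rw [← Real.exp_nat_mul]
          congr 1
          field_simp
  rw [h1, inv_pow, one_div]
  exact inv_anti₀ (by positivity) h2

/-- The error term of the upper bound on the expected number of vertices. -/
noncomputable def vertexError (d n : ℕ) : ℝ :=
  (n : ℝ) ^ (d + 1) * Real.exp (-((d + 2) * (Real.log n / n)) * (n - 1 - d))

theorem tendsto_vertexError (d : ℕ) : Tendsto (vertexError d) atTop (𝓝 0) := by
  have hlog : Tendsto (fun n : ℕ => Real.log n / n) atTop (𝓝 0) := by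
    have := Real.isLittleO_log_id_atTop.tendsto_div_nhds_zero
    exact this.comp tendsto_natCast_atTop_atTop
  -- The exponents of `n` combine to `(d + 1) - (d + 2) = -1`; the correction `-1 - d` in `n - 1 -
  -- d` leaves an exponential factor tending to 1.
  have h1 : Tendsto (fun n : ℕ => Real.exp (((d : ℝ) + 2) * (d + 1) * (Real.log n / n)) *
      (n : ℝ)⁻¹) atTop (𝓝 0) := by
    have h2 := (Real.continuous_exp.tendsto _).comp (hlog.const_mul (((d : ℝ) + 2) * (d + 1)))
    have h3 := h2.mul tendsto_natCast_atTop_atTop.inv_tendsto_atTop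
    simpa using h3
  refine h1.congr' ?_
  filter_upwards [eventually_ge_atTop 1] with n hn
  have hn' : (0 : ℝ) < n := by exact_mod_cast hn
  have h4 : (n : ℝ) ^ (d + 1) = Real.exp ((d + 1) * Real.log n) := by
    rw [← Real.exp_log hn', ← Real.exp_nat_mul]
    simp
  have h5 : (n : ℝ)⁻¹ = Real.exp (- Real.log n) := by rw [Real.exp_neg, Real.exp_log hn']
  rw [vertexError, h4, h5, ← Real.exp_add, ← Real.exp_add]
  congr 1
  field_simp
  ring

theorem inv_exp_mul_wetMeasure_le_expectedVertices {d : ℕ}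
    (μ : Measure (EuclideanSpace ℝ (Fin d))) [IsProbabilityMeasure μ] (hμ : ∀ x, μ {x} = 0)
    (N : ℕ) :
    ((N : ℝ) + 1) * (1 / Real.exp 1 * wetMeasure μ (1 / ((N : ℝ) + 1))) ≤
      expectedVertices μ (N + 1) := by
  refine le_expectedVertices μ hμ (by positivity) ?_
  rintro y ⟨h, hh, hy, ht⟩
  refine (inv_exp_one_le_one_sub_inv_pow N).trans (pow_le_outsideProb μ hh hy ?_ ht)
  rw [div_le_one (by positivity)]
  linarith [(Nat.cast_nonneg N : (0 : ℝ) ≤ N)]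

theorem expectedVertices_le_wetMeasure_add {d : ℕ}
    (μ : Measure (EuclideanSpace ℝ (Fin d))) [IsProbabilityMeasure μ] (hμ : ∀ x, μ {x} = 0)
    {n : ℕ} (hn : 1 ≤ n) :
    expectedVertices μ n ≤ n * wetMeasure μ ((d + 2) * (Real.log n / n)) + vertexError d n := by
  obtain ⟨N, rfl⟩ : ∃ N, n = N + 1 := ⟨n - 1, by omega⟩
  set t : ℝ := (d + 2) * (Real.log (N + 1 : ℕ) / (N + 1 : ℕ)) with ht_def
  have ht0 : 0 ≤ t := by
    have := Real.log_natCast_nonneg (N + 1)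
    positivity
  set δ : ℝ := ((N : ℝ) + 1) ^ d * Real.exp (-t * (N - d)) with hδ
  have herr : vertexError d (N + 1) = (N + 1) * δ := by
    rw [vertexError, hδ, ← ht_def]
    push_cast
    rw [add_sub_cancel_right]
    ring
  have hout : ∀ y, y ∉ wetPart μ t → outsideProb μ N y ≤ δ := by
    intro y hy
    have hdeep : ∀ h, IsClosedHalfspace h → y ∈ h → t < μ.real h := by
      intro h hh hyh
      by_contra hle
      exact hy ⟨h, hh, hyh, not_lt.1 hle⟩
    -- For such small samples the exponent is nonnegative, so `δ ≥ 1` and the bound is trivial.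
    by_cases hN : N ≤ d
    · refine (outsideProb_le_one μ N y).trans ?_
      have h1 : (1 : ℝ) ≤ ((N : ℝ) + 1) ^ d :=
        one_le_pow₀ (by linarith [(Nat.cast_nonneg N : (0 : ℝ) ≤ N)])
      have h2 : 1 ≤ Real.exp (-t * (N - d)) := by
        refine Real.one_le_exp ?_
        have : (N : ℝ) ≤ d := by exact_mod_cast hN
        nlinarith
      exact one_le_mul_of_one_le_of_one_le h1 h2
    · refine (outsideProb_le_of_forall_halfspace μ (by omega) (by omega) ht0 hdeep).trans ?_
      rw [hδ]
      gcongr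
      linarith
  have := expectedVertices_le μ hμ (by positivity) hout
  rw [herr, wetMeasure]
  push_cast
  linarith

/-! ### Uniform measure on a circle -/

section Circle

/-- The point of the unit circle at angle `θ`. -/
noncomputable def circlePoint (θ : ℝ) : EuclideanSpace ℝ (Fin 2) := !₂[Real.cos θ, Real.sin θ]

theorem continuous_circlePoint : Continuous circlePoint := by
  unfold circlePoint
  fun_prop

theorem norm_circlePoint (θ : ℝ) : ‖circlePoint θ‖ = 1 := by
  simp [circlePoint, EuclideanSpace.norm_eq]

theorem inner_circlePoint (φ θ : ℝ) :
    inner ℝ (circlePoint φ) (circlePoint θ) = Real.cos (θ - φ) := by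
  simp [circlePoint, PiLp.inner_apply, Fin.sum_univ_two, Real.cos_sub]

theorem exists_eq_norm_smul_circlePoint (a : EuclideanSpace ℝ (Fin 2)) :
    ∃ φ ∈ Set.Ioc (0 : ℝ) (2 * Real.pi), a = ‖a‖ • circlePoint φ := by
  set z : ℂ := ⟨a 0, a 1⟩
  have hz : ‖z‖ = ‖a‖ := by
    rw [Complex.norm_eq_sqrt_sq_add_sq, EuclideanSpace.norm_eq]
    simp [z]
  have heq : a = ‖a‖ • circlePoint z.arg := by
    have h0 := Complex.norm_mul_cos_arg z
    have h1 := Complex.norm_mul_sin_arg z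
    rw [hz] at h0 h1
    ext i
    fin_cases i
    · simpa [circlePoint] using h0.symm
    · simpa [circlePoint] using h1.symm
  have hπ := Real.pi_pos
  by_cases hpos : 0 < z.arg
  · exact ⟨z.arg, ⟨hpos, by linarith [Complex.arg_le_pi z]⟩, heq⟩
  · refine ⟨z.arg + 2 * Real.pi, ⟨by linarith [Complex.neg_pi_lt_arg z], by linarith⟩, ?_⟩
    simpa [circlePoint] using heq

/-- The angles, uniformly distributed in `(0, 2π]`. -/
noncomputable def uniformAngle : Measure ℝ :=
  ENNReal.ofReal (1 / (2 * Real.pi)) • volume.restrict (Set.Ioc 0 (2 * Real.pi))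

instance : IsProbabilityMeasure uniformAngle := by
  constructor
  have := Real.pi_pos
  rw [uniformAngle, Measure.smul_apply, Measure.restrict_apply_univ, Real.volume_Ioc, sub_zero,
    smul_eq_mul, ← ENNReal.ofReal_mul (by positivity)]
  rw [one_div, inv_mul_cancel₀ (by positivity), ENNReal.ofReal_one]

/-- The uniform distribution on the circle of radius `r` about the origin. -/
noncomputable def circleMeasure (r : ℝ) : Measure (EuclideanSpace ℝ (Fin 2)) :=
  uniformAngle.map fun θ => r • circlePoint θ

theorem measurable_smul_circlePoint (r : ℝ) : Measurable fun θ => r • circlePoint θ :=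
  (continuous_circlePoint.const_smul r).measurable

instance (r : ℝ) : IsProbabilityMeasure (circleMeasure r) :=
  Measure.isProbabilityMeasure_map (measurable_smul_circlePoint r).aemeasurable

theorem circleMeasure_singleton {r : ℝ} (hr : 0 < r) (x : EuclideanSpace ℝ (Fin 2)) :
    circleMeasure r {x} = 0 := by
  rw [circleMeasure, Measure.map_apply (measurable_smul_circlePoint r) (measurableSet_singleton x),
    uniformAngle, Measure.smul_apply]
  have hc : ((fun θ => r • circlePoint θ) ⁻¹' {x}).Countable := by
    rcases ((fun θ => r • circlePoint θ) ⁻¹' {x}).eq_empty_or_nonempty with h | ⟨θ₀, h₀⟩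
    · simp [h]
    have hsub : ((fun θ => r • circlePoint θ) ⁻¹' {x}) ⊆
        Set.range (fun k : ℤ => 2 * k * Real.pi + θ₀) ∪
          Set.range (fun k : ℤ => 2 * k * Real.pi - θ₀) := by
      intro θ hθ
      have h1 : r • circlePoint θ₀ = r • circlePoint θ := Eq.trans h₀ (Eq.symm hθ)
      have h2 : Real.cos θ₀ = Real.cos θ := by
        have := congrArg (fun z : EuclideanSpace ℝ (Fin 2) => z 0) (smul_right_injective _ hr.ne' h1)
        simpa [circlePoint] using this
      obtain ⟨k, hk | hk⟩ := Real.cos_eq_cos_iff.1 h2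
      · exact Or.inl ⟨k, hk.symm⟩
      · exact Or.inr ⟨k, hk.symm⟩
    exact ((Set.countable_range _).union (Set.countable_range _)).mono hsub
  simp [hc.measure_zero]

/-- A halfplane meeting the disc of half the radius contains a sixth of the circle. -/
theorem inv_six_le_circleMeasure_halfspace {r : ℝ} (hr : 0 < r)
    {h : Set (EuclideanSpace ℝ (Fin 2))} (hh : IsClosedHalfspace h)
    {x : EuclideanSpace ℝ (Fin 2)} (hx : x ∈ h) (hxr : ‖x‖ ≤ r / 2) :
    ENNReal.ofReal (1 / 6) ≤ circleMeasure r h := by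
  have hπ := Real.pi_pos
  have hm := hh.measurableSet
  obtain ⟨a, ha, c, rfl⟩ := hh
  obtain ⟨φ, ⟨hφ0, hφ⟩, haφ⟩ := exists_eq_norm_smul_circlePoint a
  have hapos : 0 < ‖a‖ := norm_pos_iff.2 ha
  -- Here the cosine is at least `1/2`, so the circle reaches as far in direction `a` as any point
  -- of norm at most `r / 2`.
  have hmem : ∀ θ, |θ - φ| ≤ Real.pi / 3 → r • circlePoint θ ∈ {y | c ≤ inner ℝ a y} := by
    intro θ hθ
    have hcos : 1 / 2 ≤ Real.cos (θ - φ) := by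
      rw [← Real.cos_abs, ← Real.cos_pi_div_three]
      exact Real.cos_le_cos_of_nonneg_of_le_pi (abs_nonneg _) (by linarith) hθ
    have h1 : inner ℝ a (r • circlePoint θ) = ‖a‖ * (r * Real.cos (θ - φ)) := by
      conv_lhs => rw [haφ]
      rw [inner_smul_left, inner_smul_right, inner_circlePoint]
      simp
    have h2 : c ≤ ‖a‖ * ‖x‖ := le_trans hx (real_inner_le_norm a x)
    show c ≤ inner ℝ a (r • circlePoint θ)
    rw [h1]
    refine h2.trans (mul_le_mul_of_nonneg_left ?_ hapos.le)
    nlinarith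
  -- Half of the arc suffices, taken on the side that does not wrap around; its share is `(π/3) /
  -- (2π) = 1/6`.
  have hsub : ∃ u, 0 ≤ u ∧ u + Real.pi / 3 ≤ 2 * Real.pi ∧
      Set.Ioc u (u + Real.pi / 3) ⊆ (fun θ => r • circlePoint θ) ⁻¹' {y | c ≤ inner ℝ a y} := by
    by_cases hle : φ ≤ Real.pi
    · refine ⟨φ, hφ0.le, by linarith, fun θ hθ => hmem θ ?_⟩
      rw [abs_le]
      constructor <;> linarith [hθ.1, hθ.2]
    · refine ⟨φ - Real.pi / 3, by linarith, by linarith, fun θ hθ => hmem θ ?_⟩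
      rw [abs_le]
      constructor <;> linarith [hθ.1, hθ.2]
  obtain ⟨u, hu0, hu, hsub⟩ := hsub
  rw [circleMeasure, Measure.map_apply (measurable_smul_circlePoint r) hm]
  refine le_trans ?_ (measure_mono hsub)
  rw [uniformAngle, Measure.smul_apply, Measure.restrict_apply measurableSet_Ioc,
    Set.inter_eq_left.2 (Set.Ioc_subset_Ioc hu0 hu), Real.volume_Ioc, smul_eq_mul,
    ← ENNReal.ofReal_mul (by positivity)]
  refine ENNReal.ofReal_le_ofReal (le_of_eq ?_)
  field_simp
  ring

theorem circleMeasure_apply_eq_zero {r : ℝ} (hr : 0 ≤ r) {s : Set (EuclideanSpace ℝ (Fin 2))}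
    (hs : MeasurableSet s) (hd : ∀ x ∈ s, ‖x‖ ≠ r) : circleMeasure r s = 0 := by
  rw [circleMeasure, Measure.map_apply (measurable_smul_circlePoint r) hs]
  convert measure_empty (μ := uniformAngle)
  ext θ
  simp only [Set.mem_preimage, Set.mem_empty_iff_false, iff_false]
  intro hθ
  refine hd _ hθ ?_
  rw [norm_smul, norm_circlePoint, mul_one, Real.norm_of_nonneg hr]

/-- By Cauchy–Schwarz this halfspace can meet the circle only at `y`, which is a null set. -/
theorem circleMeasure_tangent_halfspace {r : ℝ} (hr : 0 < r) {y : EuclideanSpace ℝ (Fin 2)}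
    (hy : r ≤ ‖y‖) : circleMeasure r {z | ‖y‖ ^ 2 ≤ inner ℝ y z} = 0 := by
  set h : Set (EuclideanSpace ℝ (Fin 2)) := {z | ‖y‖ ^ 2 ≤ inner ℝ y z}
  have hm : MeasurableSet h := (isClosed_le continuous_const (by fun_prop)).measurableSet
  have h0 : circleMeasure r (h \ {y}) = 0 := by
    refine circleMeasure_apply_eq_zero hr.le (hm.diff (measurableSet_singleton y)) ?_
    rintro z ⟨hz, hzy⟩ hzr
    refine hzy (Eq.symm (sub_eq_zero.1 (norm_eq_zero.1 (pow_eq_zero_iff two_ne_zero |>.1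
      (le_antisymm ?_ (sq_nonneg _))))))
    have hz' : ‖y‖ ^ 2 ≤ inner ℝ y z := hz
    have : ‖z‖ ^ 2 ≤ ‖y‖ ^ 2 := by
      rw [hzr]; gcongr
    rw [norm_sub_sq_real]
    linarith
  refine measure_mono_null (t := h \ {y} ∪ {y}) (fun z hz => ?_)
    (measure_union_null h0 (circleMeasure_singleton hr y))
  by_cases hzy : z = y
  · exact Or.inr hzy
  · exact Or.inl ⟨hz, hzy⟩

end Circle

/-! ### The counterexample measure for part (ii) -/

section NestedCircles

/-- The exponents of the masses outside the discs of radius `2 ^ i`. -/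
def tailExponent : ℕ → ℕ
  | 0 => 0
  | i + 1 => 2 * tailExponent i + 10

/-- The mass that the nested circles of index at least `i` carry together. -/
noncomputable def tailMass (i : ℕ) : ℝ := (1 / 2) ^ tailExponent i

theorem strictMono_tailExponent : StrictMono tailExponent :=
  strictMono_nat_of_lt_succ fun i => by simp only [tailExponent]; omega

theorem tailMass_succ (i : ℕ) : tailMass (i + 1) = tailMass i ^ 2 / 2 ^ 10 := by
  rw [tailMass, tailMass, tailExponent, pow_add, mul_comm 2, pow_mul]
  ring

theorem tailMass_pos (i : ℕ) : 0 < tailMass i := by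
  unfold tailMass; positivity

theorem tailMass_le_one (i : ℕ) : tailMass i ≤ 1 :=
  pow_le_one₀ (by norm_num) (by norm_num)

theorem tailMass_succ_le_half (i : ℕ) : tailMass (i + 1) ≤ tailMass i / 2 := by
  rw [tailMass_succ]
  nlinarith [tailMass_pos i, tailMass_le_one i]

theorem tendsto_tailMass : Tendsto tailMass atTop (𝓝 0) :=
  (tendsto_pow_atTop_nhds_zero_of_lt_one (by norm_num) (by norm_num)).comp
    strictMono_tailExponent.tendsto_atTop

/-- The mass of the circle of radius `2 ^ i`. -/
noncomputable def circleMass (i : ℕ) : ℝ := tailMass i - tailMass (i + 1)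

theorem half_tailMass_le_circleMass (i : ℕ) : tailMass i / 2 ≤ circleMass i := by
  have := tailMass_succ_le_half i
  unfold circleMass
  linarith

theorem circleMass_pos (i : ℕ) : 0 < circleMass i :=
  (half_pos (tailMass_pos i)).trans_le (half_tailMass_le_circleMass i)

theorem tsum_ofReal_circleMass (k : ℕ) :
    ∑' i, ENNReal.ofReal (circleMass (i + k)) = ENNReal.ofReal (tailMass k) := by
  have hs : HasSum (fun i => circleMass (i + k)) (tailMass k) := by
    rw [hasSum_iff_tendsto_nat_of_nonneg fun i => (circleMass_pos _).le]
    have h1 : ∀ n, ∑ i ∈ Finset.range n, circleMass (i + k) = tailMass k - tailMass (n + k) := by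
      intro n
      have := Finset.sum_range_sub' (fun i => tailMass (i + k)) n
      simpa [circleMass, add_right_comm] using this
    simp_rw [h1]
    simpa using ((tendsto_add_atTop_iff_nat k).2 tendsto_tailMass).const_sub (tailMass k)
  rw [← hs.tsum_eq, ENNReal.ofReal_tsum_of_nonneg (fun i => (circleMass_pos _).le) hs.summable]

/-- A mixture of the uniform distributions on the circles of radii `2 ^ i`, with masses decreasing
so fast that the mass outside the `i`-th circle is negligible at the scale of the `i`-th one. -/
noncomputable def nestedCircles : Measure (EuclideanSpace ℝ (Fin 2)) :=
  Measure.sum fun i => ENNReal.ofReal (circleMass i) • circleMeasure (2 ^ i)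

theorem nestedCircles_apply {s : Set (EuclideanSpace ℝ (Fin 2))} (hs : MeasurableSet s) :
    nestedCircles s = ∑' i, ENNReal.ofReal (circleMass i) * circleMeasure (2 ^ i) s := by
  simp [nestedCircles, Measure.sum_apply _ hs]

instance : IsProbabilityMeasure nestedCircles := by
  constructor
  rw [nestedCircles_apply MeasurableSet.univ]
  simpa [tailMass, tailExponent] using tsum_ofReal_circleMass 0

theorem nestedCircles_singleton (x : EuclideanSpace ℝ (Fin 2)) : nestedCircles {x} = 0 := by
  rw [nestedCircles_apply (measurableSet_singleton x)]
  simp [circleMeasure_singleton (show (0 : ℝ) < 2 ^ _ by positivity)]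

theorem nestedCircles_le_tailMass {s : Set (EuclideanSpace ℝ (Fin 2))} (hs : MeasurableSet s)
    {k : ℕ} (h0 : ∀ i < k, circleMeasure (2 ^ i) s = 0) : nestedCircles.real s ≤ tailMass k := by
  refine ENNReal.toReal_le_of_le_ofReal (tailMass_pos k).le ?_
  rw [nestedCircles_apply hs, ← Summable.sum_add_tsum_nat_add' (k := k) ENNReal.summable,
    ← tsum_ofReal_circleMass k, Finset.sum_eq_zero fun i hi => ?_, zero_add]
  · exact ENNReal.tsum_le_tsum fun i => mul_le_of_le_one_right' prob_le_one
  · rw [h0 i (Finset.mem_range.1 hi), mul_zero]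

theorem circleMass_mul_le_nestedCircles {s : Set (EuclideanSpace ℝ (Fin 2))}
    (hs : MeasurableSet s) (i : ℕ) {c : ℝ} (hc : ENNReal.ofReal c ≤ circleMeasure (2 ^ i) s) :
    circleMass i * c ≤ nestedCircles.real s := by
  rw [measureReal_def, ← ENNReal.ofReal_le_iff_le_toReal (measure_ne_top _ _),
    nestedCircles_apply hs, ENNReal.ofReal_mul (circleMass_pos i).le]
  refine le_trans ?_ (ENNReal.le_tsum i)
  gcongr

theorem measurableSet_setOf_le_norm (r : ℝ) :
    MeasurableSet {x : EuclideanSpace ℝ (Fin 2) | r ≤ ‖x‖} :=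
  measurableSet_le measurable_const measurable_norm

theorem circleMass_le_nestedCircles_outside (i : ℕ) :
    circleMass i ≤ nestedCircles.real {x | (2 : ℝ) ^ i ≤ ‖x‖} := by
  rw [← mul_one (circleMass i)]
  refine circleMass_mul_le_nestedCircles (measurableSet_setOf_le_norm _) i ?_
  rw [circleMeasure, Measure.map_apply (measurable_smul_circlePoint _)
    (measurableSet_setOf_le_norm _)]
  simp [Set.preimage, norm_smul, norm_circlePoint]

/-- The halfspace through `y` orthogonal to `y` is null for circles `0, …, i`, so only the tail from
`i + 1` on can charge it. -/
theorem pow_le_outsideProb_nestedCircles (i N : ℕ) {y : EuclideanSpace ℝ (Fin 2)}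
    (hy : (2 : ℝ) ^ i ≤ ‖y‖) : (1 - tailMass (i + 1)) ^ N ≤ outsideProb nestedCircles N y := by
  have hr : ∀ j : ℕ, (0 : ℝ) < 2 ^ j := fun j => by positivity
  have hh : IsClosedHalfspace {z | ‖y‖ ^ 2 ≤ inner ℝ y z} :=
    ⟨y, norm_pos_iff.1 ((hr i).trans_le hy), _, rfl⟩
  refine pow_le_outsideProb nestedCircles hh (by simp) (tailMass_le_one _)
    (nestedCircles_le_tailMass hh.measurableSet fun j hj => ?_)
  refine circleMeasure_tangent_halfspace (hr j) (le_trans ?_ hy)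
  exact pow_le_pow_right₀ one_le_two (by omega)

/-- Points of norm at most `2^i / 2` are not wet, as any halfspace through them holds a sixth of
circle `i`; the open annulus up to radius `2^i` carries no mass. -/
theorem wetMeasure_nestedCircles_le {i : ℕ} {t : ℝ} (ht : t < circleMass i / 6) :
    wetMeasure nestedCircles t ≤ nestedCircles.real {x | (2 : ℝ) ^ i ≤ ‖x‖} := by
  set G : Set (EuclideanSpace ℝ (Fin 2)) := {x | (2 : ℝ) ^ i / 2 < ‖x‖ ∧ ‖x‖ < 2 ^ i}
  have hG : MeasurableSet G := (measurableSet_lt measurable_const measurable_norm).inter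
    (measurableSet_lt measurable_norm measurable_const)
  have hG0 : nestedCircles G = 0 := by
    rw [nestedCircles_apply hG, ENNReal.tsum_eq_zero]
    intro j
    rw [circleMeasure_apply_eq_zero (by positivity) hG, mul_zero]
    rintro x ⟨h1, h2⟩ hx
    rw [hx] at h1 h2
    have h3 : j < i := (pow_lt_pow_iff_right₀ one_lt_two).1 h2
    have h4 : (2 : ℝ) ^ i < 2 ^ (j + 1) := by rw [pow_succ]; linarith
    have h5 : i < j + 1 := (pow_lt_pow_iff_right₀ one_lt_two).1 h4
    omega
  have hsub : wetPart nestedCircles t ⊆ {x | (2 : ℝ) ^ i ≤ ‖x‖} ∪ G := by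
    rintro x ⟨h, hh, hx, hle⟩
    by_cases h1 : ‖x‖ ≤ 2 ^ i / 2
    · have h2 := circleMass_mul_le_nestedCircles hh.measurableSet i
        (inv_six_le_circleMeasure_halfspace (by positivity) hh hx h1)
      linarith
    · by_cases h2 : (2 : ℝ) ^ i ≤ ‖x‖
      · exact Or.inl h2
      · exact Or.inr ⟨not_le.1 h1, not_le.1 h2⟩
  calc _ ≤ _ := measureReal_mono hsub (measure_ne_top _ _)
    _ ≤ _ := measureReal_union_le _ _
    _ = _ := by simp [measureReal_def, hG0]

theorem half_mul_wetMeasure_lt_expectedVertices (i : ℕ) {n : ℕ}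
    (hn : n = 2 ^ (2 * tailExponent i + 8)) :
    1 / 2 * n * wetMeasure nestedCircles (Real.logb 2 n / n) < expectedVertices nestedCircles n := by
  set b := tailExponent i with hb
  have hnr : (n : ℝ) = 2 ^ (2 * b + 8) := by rw [hn]; push_cast; rfl
  have hnpos : (0 : ℝ) < n := by rw [hnr]; positivity
  -- With `circleMass i ≥ 2^(-b) / 2`, this reduces to `12 * (2b + 8) < 2^(b + 8)`, which follows
  -- from `b + 1 ≤ 2^b`.
  have hlog : Real.logb 2 n / n < circleMass i / 6 := by
    have h1 : Real.logb 2 n = 2 * b + 8 := by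
      rw [hnr, Real.logb_pow, Real.logb_self_eq_one one_lt_two]
      push_cast; ring
    have h2 : tailMass i = 1 / 2 ^ b := by rw [tailMass, one_div_pow]
    have h3 : ((b : ℝ) + 1) ≤ 2 ^ b := by exact_mod_cast Nat.lt_two_pow_self
    have h4 : (2 * b + 8 : ℝ) / n < tailMass i / 2 / 6 := by
      rw [h2, hnr, div_lt_iff₀ (by positivity), pow_add, pow_mul', sq]
      field_simp
      nlinarith [(Nat.cast_nonneg b : (0 : ℝ) ≤ b)]
    rw [h1]
    linarith [half_tailMass_le_circleMass i]
  have hwet := wetMeasure_nestedCircles_le hlog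
  have hV := (circleMass_pos i).trans_le (circleMass_le_nestedCircles_outside i)
  set V := nestedCircles.real {x | (2 : ℝ) ^ i ≤ ‖x‖}
  obtain ⟨N, rfl⟩ : ∃ N, n = N + 1 := Nat.exists_eq_add_one.2 (by exact_mod_cast hnpos)
  have hmass : (N + 1 : ℝ) * tailMass (i + 1) = 1 / 4 := by
    have : tailMass (i + 1) = 1 / 2 ^ (2 * b + 8) / 4 := by
      rw [tailMass, tailExponent, one_div_pow, ← hb, show 2 * b + 10 = 2 * b + 8 + 2 by ring,
        pow_add _ _ 2]
      ring
    rw [this, ← hnr]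
    push_cast
    field_simp
  -- Bernoulli's inequality, with `N * tailMass (i + 1) ≤ 1/4`.
  have hpow : 3 / 4 ≤ (1 - tailMass (i + 1)) ^ N := by
    have h1 := one_add_mul_le_pow (a := -tailMass (i + 1))
      (by linarith [tailMass_le_one (i + 1)]) N
    have h2 := tailMass_pos (i + 1)
    rw [← sub_eq_add_neg] at h1
    linarith
  have hE := le_expectedVertices nestedCircles nestedCircles_singleton (N := N)
    (A := {x | (2 : ℝ) ^ i ≤ ‖x‖}) (δ := 3 / 4) (by norm_num)
    fun y hy => hpow.trans (pow_le_outsideProb_nestedCircles i N hy)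
  refine lt_of_lt_of_le ?_ hE
  push_cast at hnpos ⊢
  calc _ ≤ 1 / 2 * ((N : ℝ) + 1) * V := by
        push_cast at hwet
        gcongr
    _ < ((N : ℝ) + 1) * (3 / 4 * V) := by nlinarith [mul_pos hnpos hV]

end NestedCircles

/-! ### Assembly of both parts -/

theorem theorem4 :
    (∀ d : ℕ, ∃ ε : ℕ → ℝ, Tendsto ε atTop (𝓝 0) ∧
      ∀ μ : Measure (EuclideanSpace ℝ (Fin d)), IsProbabilityMeasure μ → (∀ x, μ {x} = 0) →
        ∀ n : ℕ, 1 ≤ n →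
          Integrable (fun x : Fin n → EuclideanSpace ℝ (Fin d) =>
            (numVertices (samplePolytope x) : ℝ)) (sampleLaw μ n) ∧
          1 / Real.exp 1 * n * wetMeasure μ (1 / n) ≤ expectedVertices μ n ∧
          expectedVertices μ n ≤ n * wetMeasure μ ((d + 2) * (Real.log n / n)) + ε n) ∧
    (∃ ν : Measure (EuclideanSpace ℝ (Fin 2)), IsProbabilityMeasure ν ∧ (∀ x, ν {x} = 0) ∧
      {n : ℕ | expectedVertices ν n >
        1 / 2 * n * wetMeasure ν (Real.logb 2 n / n)}.Infinite) := by
  refine ⟨fun d => ⟨vertexError d, tendsto_vertexError d, fun μ _ hμ n hn => ?_⟩,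
    nestedCircles, inferInstance, nestedCircles_singleton, ?_⟩
  · refine ⟨?_, ?_, expectedVertices_le_wetMeasure_add μ hμ hn⟩
    · obtain ⟨N, rfl⟩ := Nat.exists_eq_add_one.2 hn
      exact (integrable_numVertices_and_expectedVertices_eq μ hμ N).1
    · obtain ⟨N, rfl⟩ := Nat.exists_eq_add_one.2 hn
      refine le_trans (le_of_eq ?_) (inv_exp_mul_wetMeasure_le_expectedVertices μ hμ N)
      push_cast
      ring
  · refine Set.infinite_of_injective_forall_mem (f := fun i : ℕ => 2 ^ (2 * tailExponent i + 8))
      (fun i j hij => ?_) fun i => half_mul_wetMeasure_lt_expectedVertices i rfl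
    refine strictMono_tailExponent.injective ?_
    have := Nat.pow_right_injective le_rfl hij
    omega
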